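/- Let $G$ be a finite simple graph. There is a labelling $\ell : E(G) \to \{1,2,3\}$ with the following property. For a vertex $v$, let $\rho_\ell(v)$ denote the product of the labels $\ell(e)$ over all edges $e$ incident to $v$ (so $\rho_\ell(v)=1$ if $v$ is isolated), and for an integer $x \geq 1$ let $S_x$ be the set of vertices $v$ with $\rho_\ell(v)=x$. Then the subgraph $G[S_1]$ induced by $S_1$ consists of a (possibly empty) matching together with isolated vertices, i.e. no two distinct edges of $G[S_1]$ share a vertex, and for every $x \neq 1$ the set $S_x$ is an independent set of $G$. -/

import Mathlib

namespace SimpleGraph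

/-- A `k`-labelling of `G`: a map from the edge set of `G` to `{1, …, k}`. -/
abbrev Labelling {V : Type*} (G : SimpleGraph V) (k : ℕ) : Type _ :=
  G.edgeSet → Finset.Icc 1 k

namespace Labelling

variable {V : Type*} [Fintype V] [DecidableEq V] {G : SimpleGraph V} [DecidableRel G.Adj] {k : ℕ}

/-- The product `ρ_ℓ(v)` of the labels of the edges incident to `v`. -/
def prodAt (ℓ : G.Labelling k) (v : V) : ℕ :=
  ∏ e ∈ Finset.univ.filter (fun e : G.edgeSet => v ∈ e.val), (ℓ e : ℕ)

/-- The set `S_x` of the vertices whose product of incident labels is `x`. -/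
def prodClass (ℓ : G.Labelling k) (x : ℕ) : Set V :=
  {v | ℓ.prodAt v = x}

end Labelling

/-- The set `S` induces a (possibly empty) matching and isolated vertices: some matching of
the induced graph `G[S]` contains all the edges of `G[S]`, so that the vertices of `S` which the
matching does not cover are isolated in `G[S]`. -/
def InducesMatchingAndIsolated {V : Type*} (G : SimpleGraph V) (S : Set V) : Prop :=
  ∃ M : (G.induce S).Subgraph, M.IsMatching ∧ M.edgeSet = (G.induce S).edgeSet

end SimpleGraph

/-! ### Pairs of exponents in place of products -/

namespace SimpleGraph

open Finset

/-! A product is `2 ^ a * 3 ^ b`, so it is enough that the pairs `(a, b)` counting labels 2 and 3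
separate adjacent vertices, except for a matching on `(0, 0)`. Take a greedy proper colouring by
levels `0, 1, 2, …`.

High levels (`exists_lower_choice`): a vertex of level at least 2 picks some lower neighbours, and a
picked edge gets 2 if its lower end has even level, 3 otherwise. Hence an even vertex receives only
2s from above and an odd one only 3s, and the other coordinate is its own to fix: `b = k` on level
`2k`, `a = m + 1` on level `2m + 1`. This separates levels of equal parity. The received coordinate
is adjusted to be positive with `a ≡ k`, resp. `b ≡ m` mod 2; equality of an even and an odd pair
would then force both `k ≡ m + 1` and `k ≡ m`.

Low levels (`exists_bipartite_labelling`): levels 0 and 1 span a bipartite graph. A `T`-join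
labelled 2 makes `a` even on level 1 and odd on level 0, up to harmless vertices already holding 2s
and at most one defect `(0, 0)` per component, which is repaired or left in the matching. Low pairs
have a zero coordinate or equal `(1, 2)`, and no high vertex has such a pair. -/

/-- The edge labels of two disjoint subgraphs, `2` on the first and `3` on the second one, yield a
labelling whose vertex products are read off from the degrees in these subgraphs. -/
theorem exists_labelling_prodAt_eq {V : Type*} [Fintype V] [DecidableEq V] (G : SimpleGraph V)
    [DecidableRel G.Adj] (G₂ G₃ : SimpleGraph V) (h₂ : G₂ ≤ G) (h₃ : G₃ ≤ G)
    (hd : ∀ u v, G₂.Adj u v → ¬ G₃.Adj u v) :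
    ∃ ℓ : G.Labelling 3, ∀ v,
      ℓ.prodAt v = 2 ^ (G₂.neighborSet v).ncard * 3 ^ (G₃.neighborSet v).ncard := by
  classical
  have key : ∀ (K : SimpleGraph V) (_ : K ≤ G) (n : ℕ) (v : V),
      ∏ e ∈ univ.filter (fun e : G.edgeSet => v ∈ e.val), (if e.val ∈ K.edgeSet then n else 1) =
        n ^ (K.neighborSet v).ncard := by
    intro K hK n v
    rw [Finset.prod_ite, prod_const, prod_const_one, mul_one, filter_filter,
      Set.ncard_eq_toFinset_card']
    congr 1
    symm
    refine Finset.card_bij (fun u hu => ⟨s(v, u), hK (by simpa using hu)⟩) ?_ ?_ ?_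
    · intro u hu
      simpa using hu
    · intro u hu w hw h
      exact Sym2.congr_right.mp (congrArg Subtype.val h)
    · rintro ⟨e, he⟩ h
      simp only [mem_filter, mem_univ, true_and] at h
      obtain ⟨⟨u, rfl⟩, h2⟩ := h
      exact ⟨u, by simpa using h2, rfl⟩
  refine ⟨fun e => ⟨if e.val ∈ G₂.edgeSet then 2 else if e.val ∈ G₃.edgeSet then 3 else 1, ?_⟩,
    fun v => ?_⟩
  · split_ifs <;> simp
  · rw [Labelling.prodAt, ← key G₂ h₂ 2 v, ← key G₃ h₃ 3 v, ← Finset.prod_mul_distrib]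
    refine Finset.prod_congr rfl fun e _ => ?_
    obtain ⟨e, he⟩ := e
    induction e using Sym2.ind with
    | _ x y =>
      have := hd x y
      simp only [mem_edgeSet]
      split_ifs <;> simp_all

theorem two_pow_mul_three_pow_inj {a b c d : ℕ} (h : 2 ^ a * 3 ^ b = 2 ^ c * 3 ^ d) :
    a = c ∧ b = d := by
  have h1 := congrArg (fun n => n.factorization 2) h
  have h2 := congrArg (fun n => n.factorization 3) h
  simp only [Nat.factorization_mul, ne_eq, pow_eq_zero_iff', OfNat.ofNat_ne_zero, false_and,
    not_false_eq_true, Nat.factorization_pow, Finsupp.coe_add, Finsupp.coe_smul, Pi.add_apply,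
    Pi.smul_apply, smul_eq_mul, Nat.prime_two.factorization, Nat.prime_three.factorization,
    Finsupp.single_apply] at h1 h2
  simp at h1 h2
  exact ⟨h1, h2⟩

theorem inducesMatchingAndIsolated_of_unique {V : Type*} (G : SimpleGraph V) (S : Set V)
    (h : ∀ v ∈ S, ∀ u ∈ S, ∀ w ∈ S, G.Adj v u → G.Adj v w → u = w) :
    G.InducesMatchingAndIsolated S := by
  refine ⟨{ verts := {v | ∃ w, (G.induce S).Adj v w}
            Adj := (G.induce S).Adj
            adj_sub := id
            edge_vert := fun {v w} hv => ⟨w, hv⟩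
            symm := ⟨fun _ _ hv => hv.symm⟩ }, ?_, ?_⟩
  · rintro v ⟨w, hw⟩
    refine ⟨w, hw, fun u hu => ?_⟩
    exact Subtype.ext (h v v.2 u u.2 w w.2 hu hw)
  · ext e
    induction e using Sym2.ind with
    | _ x y => simp

/-- It suffices to find two disjoint subgraphs whose pairs of degrees tell adjacent vertices
apart, up to a matching of vertices with both degrees zero. -/
theorem exists_labelling_of_degree_pairs {V : Type*} [Fintype V] [DecidableEq V]
    (G : SimpleGraph V) [DecidableRel G.Adj] (G₂ G₃ : SimpleGraph V) (h₂ : G₂ ≤ G) (h₃ : G₃ ≤ G)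
    (hd : ∀ u v, G₂.Adj u v → ¬ G₃.Adj u v) (a b : V → ℕ)
    (ha : ∀ v, (G₂.neighborSet v).ncard = a v) (hb : ∀ v, (G₃.neighborSet v).ncard = b v)
    (hne : ∀ u v, G.Adj u v → a u = a v → b u = b v → a u = 0 ∧ b u = 0)
    (huniq : ∀ v u w, G.Adj v u → G.Adj v w → a v = 0 → b v = 0 → a u = 0 → b u = 0 →
      a w = 0 → b w = 0 → u = w) :
    ∃ ℓ : G.Labelling 3,
      G.InducesMatchingAndIsolated (ℓ.prodClass 1) ∧
        ∀ x : ℕ, x ≠ 1 → G.IsIndepSet (ℓ.prodClass x) := by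
  obtain ⟨ℓ, hℓ⟩ := exists_labelling_prodAt_eq G G₂ G₃ h₂ h₃ hd
  simp only [ha, hb] at hℓ
  have h1 : ∀ v, v ∈ ℓ.prodClass 1 → a v = 0 ∧ b v = 0 := by
    intro v hv
    have hv' : ℓ.prodAt v = 1 := hv
    rw [hℓ] at hv'
    exact two_pow_mul_three_pow_inj (c := 0) (d := 0) (by simpa using hv')
  refine ⟨ℓ, inducesMatchingAndIsolated_of_unique G _ ?_, ?_⟩
  · intro v hv u hu w hw hvu hvw
    exact huniq v u w hvu hvw (h1 v hv).1 (h1 v hv).2 (h1 u hu).1 (h1 u hu).2 (h1 w hw).1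
      (h1 w hw).2
  · intro x hx u hu v hv _ huv
    have hu' : ℓ.prodAt u = x := hu
    have hv' : ℓ.prodAt v = x := hv
    rw [hℓ] at hu' hv'
    obtain ⟨e1, e2⟩ := two_pow_mul_three_pow_inj (hu'.trans hv'.symm)
    obtain ⟨e3, e4⟩ := hne u v huv e1 e2
    rw [e3, e4] at hu'
    exact hx (by simpa using hu'.symm)

/-! ### Greedy levels and choices from the top level downwards -/

/-- Proper colourings of least sum are greedy: each vertex sees all smaller colours. -/
theorem exists_greedy_level {V : Type*} [Fintype V] (G : SimpleGraph V) :
    ∃ lev : V → ℕ, (∀ u v, G.Adj u v → lev u ≠ lev v) ∧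
      ∀ v, ∀ j < lev v, ∃ u, G.Adj v u ∧ lev u = j := by
  classical
  have hex : ∃ n, ∃ lev : V → ℕ, (∀ u v, G.Adj u v → lev u ≠ lev v) ∧ ∑ v, lev v = n :=
    ⟨_, fun v => Fintype.equivFin V v, fun u v h e => h.ne
      ((Fintype.equivFin V).injective (Fin.ext e)), rfl⟩
  obtain ⟨lev, h1, h2⟩ := Nat.find_spec hex
  refine ⟨lev, h1, fun v j hj => ?_⟩
  by_contra! hcon
  -- If `v` misses the smaller colour `j`, recolouring `v` with `j` stays proper and lowers the sum.
  have hlt : ∑ w, Function.update lev v j w < ∑ w, lev w := by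
    refine Finset.sum_lt_sum (fun w _ => ?_) ⟨v, mem_univ v, by simpa using hj⟩
    by_cases hw : w = v
    · subst hw; simpa using hj.le
    · simp [hw]
  refine Nat.find_min hex (hlt.trans_eq h2) ⟨_, fun u w huw => ?_, rfl⟩
  by_cases hu : u = v
  · subst hu
    rw [Function.update_self, Function.update_of_ne huw.ne']
    exact (hcon w huw).symm
  · by_cases hw : w = v
    · subst hw
      rw [Function.update_self, Function.update_of_ne huw.ne]
      exact hcon u huw.symm
    · rw [Function.update_of_ne hu, Function.update_of_ne hw]
      exact h1 u w huw

/-- In a graph whose vertices carry ranks, sets of neighbours of smaller rank can be chosen from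
the top rank downwards, each choice taking into account how often the vertex was chosen before. -/
theorem exists_descending_choice {V : Type*} [Fintype V] (lev : V → ℕ)
    (P : V → Finset V → ℕ → Prop)
    (hP : ∀ v n, ∃ C : Finset V, (∀ u ∈ C, lev u < lev v) ∧ P v C n) :
    ∃ C : V → Finset V, (∀ v, ∀ u ∈ C v, lev u < lev v) ∧
      ∀ v, P v (C v) {w | v ∈ C w}.ncard := by
  classical
  -- Downward induction on `k`, with the levels from `k` up settled; `n` bounds how many levels
  -- these are.
  suffices h : ∀ n k, (∀ v, lev v < k + n) → ∃ C : V → Finset V,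
      (∀ v, ∀ u ∈ C v, lev u < lev v) ∧
      ∀ v, k ≤ lev v → P v (C v) {w | v ∈ C w}.ncard by
    obtain ⟨N, hN⟩ : ∃ N, ∀ v, lev v < N :=
      ⟨univ.sup lev + 1, fun v => Nat.lt_succ_of_le (Finset.le_sup (mem_univ v))⟩
    obtain ⟨C, h1, h2⟩ := h N 0 (by simpa using hN)
    exact ⟨C, h1, fun v => h2 v (Nat.zero_le _)⟩
  intro n
  induction n with
  | zero =>
    intro k hk
    exact ⟨fun _ => ∅, by simp, fun v hv => absurd (hk v) (by omega)⟩
  | succ n ih =>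
    intro k hk
    obtain ⟨C, h1, h2⟩ := ih (k + 1) (fun v => by have := hk v; omega)
    choose F hF1 hF2 using hP
    -- Vertices of level `k` choose only below `k`, so their new choices leave the counts at all
    -- levels from `k` up unchanged.
    refine ⟨fun v => if lev v = k then F v {w | v ∈ C w ∧ lev w ≠ k}.ncard else C v, ?_, ?_⟩
    · intro v u hu
      dsimp only at hu
      split_ifs at hu
      · exact hF1 _ _ u hu
      · exact h1 v u hu
    · intro v hv
      have hset : {w | v ∈ if lev w = k then F w {x | w ∈ C x ∧ lev x ≠ k}.ncard else C w} =
          {w | v ∈ C w ∧ lev w ≠ k} := by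
        ext w
        by_cases hw : lev w = k
        · simp only [hw, if_true, Set.mem_ofPred_eq, ne_eq, not_true_eq_false, and_false, iff_false]
          intro hmem
          have := hF1 _ _ _ hmem
          omega
        · simp [hw]
      simp only [hset]
      by_cases hvk : lev v = k
      · simp only [hvk, if_true]
        exact hF2 _ _
      · simp only [hvk, if_false]
        have hs : {w | v ∈ C w ∧ lev w ≠ k} = {w | v ∈ C w} := by
          ext w
          simp only [Set.mem_ofPred_eq, and_iff_left_iff_imp]
          intro hw
          have := h1 _ _ hw
          omega
        rw [hs]
        exact h2 v (by omega)

end SimpleGraph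

/-! ### `T`-joins by linear algebra mod 2 -/

namespace SimpleGraph

open Finset

/-- `f` counts mod 2 how often a walk uses each edge; inner visits cancel, and the two ends cancel
as well when `x = r`. -/
theorem Reachable.exists_path_chain {V : Type*} [Fintype V] [DecidableEq V] {Γ : SimpleGraph V}
    {r x : V} (h : Γ.Reachable r x) :
    ∃ f : V → V → ZMod 2, (∀ u v, f u v = f v u) ∧ (∀ u v, f u v ≠ 0 → Γ.Adj u v) ∧
      ∀ v, ∑ u, f v u = (if v = x then 1 else 0) + (if v = r then 1 else 0) := by
  obtain ⟨p⟩ := h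
  induction p with
  | nil =>
    refine ⟨fun _ _ => 0, by simp, by simp, fun v => ?_⟩
    rw [CharTwo.add_self_eq_zero]
    simp
  | @cons u w x huw p ih =>
    obtain ⟨f, f1, f2, f3⟩ := ih
    refine ⟨fun a b => f a b + ((if a = u then if b = w then 1 else 0 else 0) +
      (if a = w then if b = u then 1 else 0 else 0)), ?_, ?_, ?_⟩
    · intro a b
      dsimp only
      rw [f1 a b, add_comm (ite (a = u) _ _)]
      congr 2 <;> split_ifs <;> rfl
    · intro a b hab
      by_contra hn
      apply hab
      have : f a b = 0 := by by_contra h0; exact hn (f2 a b h0)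
      dsimp only
      rw [this]
      have n1 : ¬ (a = u ∧ b = w) := fun ⟨e1, e2⟩ => hn (e1 ▸ e2 ▸ huw)
      have n2 : ¬ (a = w ∧ b = u) := fun ⟨e1, e2⟩ => hn (e1 ▸ e2 ▸ huw.symm)
      rw [← ite_and, ← ite_and, if_neg n1, if_neg n2]
      simp
    · intro v
      rw [Finset.sum_add_distrib, Finset.sum_add_distrib, f3 v]
      have e1 : ∀ (c : Prop) [Decidable c] (d : V),
          ∑ b, (if c then if b = d then (1 : ZMod 2) else 0 else 0) = if c then 1 else 0 := by
        intro c _ d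
        split_ifs <;> simp
      rw [e1, e1]
      have := CharTwo.add_self_eq_zero (if v = w then (1 : ZMod 2) else 0)
      linear_combination this

/-- Subgraphs with prescribed degree parities (`T`-joins) exist within a component in which the
prescribed parities have even sum. -/
theorem exists_subgraph_ncard_neighborSet_eq {V : Type*} [Fintype V] (Γ : SimpleGraph V) (r : V)
    (t : V → ZMod 2) (ht : ∀ x, t x ≠ 0 → Γ.Reachable r x) (hsum : ∑ x, t x = 0) :
    ∃ J ≤ Γ, ∀ v, ((J.neighborSet v).ncard : ZMod 2) = t v := by
  classical
  have hf : ∀ x, ∃ f : V → V → ZMod 2, (∀ u v, f u v = f v u) ∧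
      (∀ u v, f u v ≠ 0 → Γ.Adj u v) ∧ ∀ v, ∑ u, t x * f v u =
        t x * ((if v = x then 1 else 0) + (if v = r then 1 else 0)) := by
    intro x
    by_cases h : t x = 0
    · exact ⟨fun _ _ => 0, by simp, by simp, by simp [h]⟩
    · obtain ⟨f, f1, f2, f3⟩ := (ht x h).exists_path_chain
      exact ⟨f, f1, f2, fun v => by rw [← Finset.mul_sum, f3]⟩
  choose f f1 f2 f3 using hf
  -- Superpose walks from `r` to every `x` with `t x = 1`. The excess at `r` is `∑ x, t x = 0`.
  set g : V → V → ZMod 2 := fun u v => ∑ x, t x * f x u v with hg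
  have g1 : ∀ u v, g u v = g v u := fun u v => by simp only [hg, f1 _ u v]
  have g2 : ∀ u v, g u v ≠ 0 → Γ.Adj u v := by
    intro u v h
    obtain ⟨x, -, hx⟩ := Finset.exists_ne_zero_of_sum_ne_zero h
    exact f2 x u v (right_ne_zero_of_mul hx)
  refine ⟨{ Adj := fun u v => g u v ≠ 0
            symm := ⟨fun u v h => by rwa [g1 v u]⟩
            loopless := ⟨fun u h => (g2 u u h).ne rfl⟩ }, fun u v h => g2 u v h, fun v => ?_⟩
  have hc : (({u | g v u ≠ 0} : Set V).ncard : ZMod 2) = ∑ u, g v u := by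
    rw [Set.ncard_eq_toFinset_card', Set.toFinset_ofPred, ← Finset.sum_boole]
    refine Finset.sum_congr rfl fun u _ => ?_
    generalize g v u = z
    revert z
    decide
  refine hc.trans ?_
  simp only [hg]
  rw [Finset.sum_comm]
  simp only [f3, mul_add, Finset.sum_add_distrib, ← Finset.sum_mul, hsum]
  simp

end SimpleGraph

/-! ### Parity subgraphs with at most one defect per component -/

namespace SimpleGraph

open Finset

/-- The edges of `Γ` with both ends in `K`, as a graph on the same vertex set. -/
def within {V : Type*} (Γ : SimpleGraph V) (K : Set V) : SimpleGraph V where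
  Adj u v := Γ.Adj u v ∧ u ∈ K ∧ v ∈ K
  symm := ⟨fun _ _ h => ⟨h.1.symm, h.2.2, h.2.1⟩⟩
  loopless := ⟨fun _ h => h.1.ne rfl⟩

theorem reachable_within_of_forall_mem {V : Type*} {Γ : SimpleGraph V} {K : Set V} {u v : V}
    (p : Γ.Walk u v) (hp : ∀ w ∈ p.support, w ∈ K) : (Γ.within K).Reachable u v := by
  induction p with
  | nil => exact Reachable.refl _
  | @cons u w v h p ih =>
    have h1 : (Γ.within K).Adj u w := ⟨h, hp _ (by simp), hp _ (by simp)⟩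
    exact h1.reachable.trans (ih fun x hx => hp x (by simp [hx]))

/-- Let `r ∈ A`, where the vertices of `A` have odd weight. Then there are a set `K` of even total
weight, connected in itself and containing `r` unless empty, and a set `X` of at most one vertex
of `A` outside `K`, which together cover the part of `A` in the component of `r`. A vertex of `K`
other than some `x₀ ∈ A` has neighbours in `K ∪ X` only. -/
theorem exists_even_connected_set {V : Type*} [Fintype V] (Γ : SimpleGraph V) (A : Set V)
    (t : V → ZMod 2) (htA : ∀ v ∈ A, t v = 1) (r : V) (hr : r ∈ A) :
    ∃ (K X : Set V) (x₀ : V), X ⊆ {x₀} ∧ x₀ ∈ A ∧ X ⊆ A ∧ (∀ v ∈ X, Γ.Reachable r v ∧ v ∉ K) ∧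
      (∀ v ∈ A, Γ.Reachable r v → v ∈ K ∪ X) ∧
      (∀ v ∈ K, (Γ.within K).Reachable r v) ∧
      (∀ u ∈ K, ∀ v, Γ.Adj u v → u ≠ x₀ → v ∈ K ∪ X) ∧
      (letI := Classical.decPred (· ∈ K); ∑ v, if v ∈ K then t v else 0) = 0 := by
  classical
  -- `x₀` is a vertex of `A` farthest from `r`, so deleting it cuts no other vertex of `A` off from
  -- `r`: a shortest path through `x₀` would end farther away.
  obtain ⟨x₀, hx₀, hmax⟩ := Finset.exists_max_image
    (univ.filter fun v => v ∈ A ∧ Γ.Reachable r v) (fun v => Γ.dist r v)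
    ⟨r, by simp [hr]⟩
  simp only [mem_filter, mem_univ, true_and] at hx₀ hmax
  by_cases hxr : x₀ = r
  · subst hxr
    refine ⟨∅, {x₀}, x₀, subset_rfl, hr, by simpa using hr, by simp, ?_, by simp, by simp, by simp⟩
    intro v hv hrv
    have := hmax v ⟨hv, hrv⟩
    rw [dist_self, Nat.le_zero, hrv.dist_eq_zero_iff] at this
    simp [this]
  set K : Set V := {v | (Γ.within {x₀}ᶜ).Reachable r v} with hK
  have hxK : x₀ ∉ K := by
    rintro ⟨p⟩
    cases p.reverse with
    | nil => exact hxr rfl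
    | cons h _ => exact h.2.1 rfl
  have hKadj : ∀ u ∈ K, ∀ v, Γ.Adj u v → v ≠ x₀ → v ∈ K := by
    intro u hu v huv hv
    have h1 : (Γ.within {x₀}ᶜ).Adj u v := ⟨huv, fun h => hxK (h ▸ hu), hv⟩
    exact Reachable.trans hu h1.reachable
  have hAK : ∀ v ∈ A, Γ.Reachable r v → v ≠ x₀ → v ∈ K := by
    intro v hv hrv hne
    obtain ⟨p, hp⟩ := hrv.exists_walk_length_eq_dist
    refine reachable_within_of_forall_mem p fun w hw hwx => ?_
    have hwx : w = x₀ := hwx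
    subst hwx
    have h1 := hmax v ⟨hv, hrv⟩
    have h2 := dist_le (p.takeUntil w hw)
    have h3 := congrArg Walk.length (p.take_spec hw)
    rw [Walk.length_append] at h3
    have h4 : (p.dropUntil w hw).length = 0 := by omega
    exact hne (Walk.eq_of_length_eq_zero h4).symm
  have hKK : ∀ K' : Set V, K ⊆ K' → ∀ v ∈ K, (Γ.within K').Reachable r v := by
    intro K' hK' v hv
    obtain ⟨p⟩ := id hv
    have aux : ∀ {a b : V} (q : (Γ.within {x₀}ᶜ).Walk a b), a ∈ K →
        (Γ.within K').Reachable a b := by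
      intro a b q
      induction q with
      | nil => exact fun _ => Reachable.refl _
      | @cons a c b h q ih =>
        intro ha
        have hc : c ∈ K := hKadj a ha c h.1 h.2.2
        have h1 : (Γ.within K').Adj a c := ⟨h.1, hK' ha, hK' hc⟩
        exact h1.reachable.trans (ih hc)
    exact aux p (Reachable.refl _)
  by_cases hsum : (∑ v, if v ∈ K then t v else 0) = 0
  · refine ⟨K, {x₀}, x₀, subset_rfl, hx₀.1, by simpa using hx₀.1, ?_, ?_, hKK K subset_rfl, ?_, ?_⟩
    · rintro v rfl
      exact ⟨hx₀.2, hxK⟩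
    · intro v hv hrv
      by_cases h : v = x₀
      · exact Or.inr h
      · exact Or.inl (hAK v hv hrv h)
    · intro u hu v huv _
      by_cases h : v = x₀
      · exact Or.inr h
      · exact Or.inl (hKadj u hu v huv h)
    · convert hsum
  -- The sum over `K` is odd, and `x₀` has weight 1: adding `x₀`, which has a neighbour in `K`,
  -- makes it even.
  · have hnb : ∃ y ∈ K, Γ.Adj y x₀ := by
      obtain ⟨p⟩ := hx₀.2
      have aux : ∀ {a b : V} (q : Γ.Walk a b), a ∈ K → b = x₀ → ∃ y ∈ K, Γ.Adj y x₀ := by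
        intro a b q
        induction q with
        | nil => exact fun h1 h2 => absurd (h2 ▸ h1) hxK
        | @cons a c b h q ih =>
          intro ha hb
          by_cases hc : c = x₀
          · exact ⟨a, ha, hc ▸ h⟩
          · exact ih (hKadj a ha c h hc) hb
      exact aux p (Reachable.refl _) rfl
    refine ⟨insert x₀ K, ∅, x₀, by simp, hx₀.1, by simp, by simp, ?_, ?_, ?_, ?_⟩
    · intro v hv hrv
      by_cases h : v = x₀
      · exact Or.inl (Or.inl h)
      · exact Or.inl (Or.inr (hAK v hv hrv h))
    · rintro v (rfl | hv)
      · obtain ⟨y, hy, hyx⟩ := hnb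
        have h1 : (Γ.within (insert v K)).Adj y v := ⟨hyx, Or.inr hy, Or.inl rfl⟩
        exact (hKK _ (Set.subset_insert _ _) y hy).trans h1.reachable
      · exact hKK _ (Set.subset_insert _ _) v hv
    · rintro u (rfl | hu) v huv hne
      · exact absurd rfl hne
      · by_cases h : v = x₀
        · exact Or.inl (Or.inl h)
        · exact Or.inl (Or.inr (hKadj u hu v huv h))
    · have e1 : ∀ v, (if v ∈ insert x₀ K then t v else 0) =
          (if v ∈ K then t v else 0) + (if v = x₀ then 1 else 0) := by
        intro v
        by_cases h : v = x₀
        · subst h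
          simp [hxK, htA v hx₀.1]
        · simp [h]
      have e2 : (∑ v, if v ∈ K then t v else 0) = 1 := by
        generalize (∑ v, if v ∈ K then t v else 0) = z at hsum
        revert z
        decide
      have : (∑ v, if v ∈ insert x₀ K then t v else 0) = 0 := by
        simp only [e1, Finset.sum_add_distrib, e2]
        simp
        decide
      convert this

/-- On the vertices of `c`, the degrees in the subgraph `J` are even on the side `s`, and make `e`
odd on the other side, apart from the isolated vertices in `X` and from some vertices with `e`
positive that are isolated in `J` together with all their neighbours in `Γ`. -/
structure IsParitySubgraph {V : Type*} (Γ : SimpleGraph V) (s : V → Prop) (e : V → ℕ) (c : Set V)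
    (J : SimpleGraph V) (X : Set V) : Prop where
  le : J ≤ Γ
  defect : ∀ x ∈ X, ¬ s x ∧ e x = 0 ∧ (J.neighborSet x).ncard = 0
  even : ∀ y ∈ c, s y → Even (J.neighborSet y).ncard
  odd : ∀ u ∈ c, ¬ s u → u ∉ X → Odd (e u + (J.neighborSet u).ncard) ∨
    (0 < e u ∧ (J.neighborSet u).ncard = 0 ∧ ∀ y, Γ.Adj u y → (J.neighborSet y).ncard = 0)

/-- The vertices needing a `J`-edge are those off `s` with `e = 0`; they form `A`. A vertex off `s`
outside `K ∪ X` thus has `e` positive, and its neighbours avoid `K` too: they lie in `s`, hence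
differ from `x₀`. -/
theorem exists_isParitySubgraph_component {V : Type*} [Fintype V] (Γ : SimpleGraph V)
    (s : V → Prop) (hs : ∀ u v, Γ.Adj u v → (s u ↔ ¬ s v)) (e : V → ℕ) (c : Γ.ConnectedComponent) :
    ∃ J X, IsParitySubgraph Γ s e c.supp J X ∧ X.Subsingleton ∧ X ⊆ c.supp := by
  classical
  by_cases hA : ∃ r ∈ c.supp, ¬ s r ∧ e r = 0
  · obtain ⟨r, hrc, hr⟩ := hA
    obtain ⟨K, X, x₀, h1, h2, h3, h4, h5, h6, h7, h8⟩ :=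
      exists_even_connected_set Γ {v | ¬ s v ∧ e v = 0}
        (fun v => if s v then 0 else 1 + e v) (by rintro v ⟨hv, hv'⟩; simp [hv, hv']) r hr
    obtain ⟨J, hJ, hdeg⟩ := exists_subgraph_ncard_neighborSet_eq (Γ.within K) r
      (fun v => if v ∈ K then if s v then 0 else 1 + e v else 0)
      (fun x hx => h6 x (by by_contra h; simp [h] at hx)) (by convert h8)
    have hrc' : ∀ v, v ∈ c.supp ↔ Γ.Reachable r v := by
      intro v
      rw [ConnectedComponent.mem_supp_iff] at hrc ⊢
      rw [← hrc, ConnectedComponent.eq]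
      exact ⟨Reachable.symm, Reachable.symm⟩
    have hnot : ∀ v, v ∉ K → (J.neighborSet v).ncard = 0 := by
      intro v hv
      rw [Set.ncard_eq_zero]
      ext w
      simp only [mem_neighborSet, Set.mem_empty_iff_false, iff_false]
      exact fun h => hv (hJ h).2.1
    refine ⟨J, X, ⟨fun u v h => (hJ h).1, ?_, ?_, ?_⟩, ?_, ?_⟩
    · intro x hx
      exact ⟨(h3 hx).1, (h3 hx).2, hnot x (h4 x hx).2⟩
    · intro y _ hy
      rw [← ZMod.natCast_eq_zero_iff_even, hdeg]
      simp [hy]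
    · intro u hu hsu huX
      by_cases huK : u ∈ K
      · left
        rw [← ZMod.natCast_eq_one_iff_odd, Nat.cast_add, hdeg]
        simp only [huK, hsu, if_true, if_false]
        linear_combination CharTwo.add_self_eq_zero (e u : ZMod 2)
      · right
        refine ⟨?_, hnot u huK, ?_⟩
        · by_contra h0
          rcases h5 u ⟨hsu, by omega⟩ ((hrc' u).1 hu) with h | h
          · exact huK h
          · exact huX h
        · intro y huy
          refine hnot y fun hyK => ?_
          have hys : s y := by have := hs u y huy; tauto
          rcases h7 y hyK u huy.symm (fun h => h2.1 (h ▸ hys)) with h | h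
          · exact huK h
          · exact huX h
    · exact Set.subsingleton_singleton.anti h1
    · intro x hx
      exact (hrc' x).2 (h4 x hx).1
  -- Every vertex off `s` already has `e` positive, so the empty subgraph serves.
  · push Not at hA
    refine ⟨⊥, ∅, ⟨bot_le, by simp, by simp [neighborSet], ?_⟩, by simp, by simp⟩
    intro u hu hsu _
    right
    exact ⟨Nat.pos_of_ne_zero (hA u hu hsu), by simp [neighborSet], by simp [neighborSet]⟩

theorem exists_isParitySubgraph {V : Type*} [Fintype V] (Γ : SimpleGraph V)
    (s : V → Prop) (hs : ∀ u v, Γ.Adj u v → (s u ↔ ¬ s v)) (e : V → ℕ) :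
    ∃ J X, IsParitySubgraph Γ s e Set.univ J X ∧
      ∀ x ∈ X, ∀ x' ∈ X, Γ.Reachable x x' → x = x' := by
  choose J X hJ hX1 hX2 using exists_isParitySubgraph_component Γ s hs e
  let J' : SimpleGraph V :=
    { Adj := fun u v => (J (Γ.connectedComponentMk u)).Adj u v
      symm := ⟨fun u v h => by
        have huv := ConnectedComponent.sound ((hJ _).le h).reachable
        rw [← huv]
        exact h.symm⟩
      loopless := ⟨fun u h => h.ne rfl⟩ }
  have hN : ∀ v, J'.neighborSet v = (J (Γ.connectedComponentMk v)).neighborSet v := fun _ => rfl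
  refine ⟨J', {x | x ∈ X (Γ.connectedComponentMk x)}, ⟨fun u v h => (hJ _).le h, ?_, ?_, ?_⟩, ?_⟩
  · intro x hx
    rw [hN]
    exact (hJ _).defect x hx
  · intro y _ hy
    rw [hN]
    exact (hJ _).even y rfl hy
  · intro u _ hsu hu
    rw [hN]
    refine ((hJ _).odd u rfl hsu hu).imp_right fun ⟨h1, h2, h3⟩ => ⟨h1, h2, fun y hy => ?_⟩
    rw [hN, ← ConnectedComponent.sound hy.reachable]
    exact h3 y hy
  · intro x hx x' hx' h
    have hc := ConnectedComponent.sound h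
    have hx'' : x' ∈ X (Γ.connectedComponentMk x) := by rw [hc]; exact hx'
    exact hX1 _ hx hx''

end SimpleGraph

/-! ### Labelling the two lowest levels -/

namespace SimpleGraph

open Finset

/-- Existence of maximal matchings between a set `X` and its neighbours satisfying `q`. -/
theorem exists_maximal_pairing {V : Type*} [Finite V] (H : SimpleGraph V) (X : Set V)
    (q : V → Prop) :
    ∃ M : V → V → Prop, (∀ x w, M x w → x ∈ X ∧ H.Adj x w ∧ q w) ∧
      (∀ x w w', M x w → M x w' → w = w') ∧ (∀ x x' w, M x w → M x' w → x = x') ∧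
      ∀ x ∈ X, ∀ w, H.Adj x w → q w → (∀ w', ¬ M x w') → ∃ x', M x' w := by
  let P : Set (Set (V × V)) := {M | (∀ x w, (x, w) ∈ M → x ∈ X ∧ H.Adj x w ∧ q w) ∧
      (∀ x w w', (x, w) ∈ M → (x, w') ∈ M → w = w') ∧
      (∀ x x' w, (x, w) ∈ M → (x', w) ∈ M → x = x')}
  obtain ⟨M, ⟨h1, h2, h3⟩, hmax⟩ := P.toFinite.exists_maximal ⟨∅, by simp [P]⟩
  refine ⟨fun x w => (x, w) ∈ M, h1, h2, h3, fun x hx w hxw hq hfree => ?_⟩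
  by_contra! hcon
  have hP : insert (x, w) M ∈ P := by
    refine ⟨?_, ?_, ?_⟩
    · rintro a b (h | h)
      · cases h
        exact ⟨hx, hxw, hq⟩
      · exact h1 a b h
    · rintro a b b' (h | h) (h' | h')
      · cases h; cases h'; rfl
      · cases h; exact absurd h' (hfree _)
      · cases h'; exact absurd h (hfree _)
      · exact h2 a b b' h h'
    · rintro a a' b (h | h) (h' | h')
      · cases h; cases h'; rfl
      · cases h; exact absurd h' (hcon _)
      · cases h'; exact absurd h (hcon _)
      · exact h3 a a' b h h'
  exact hcon x (hmax hP (Set.subset_insert _ _) (Set.mem_insert _ _))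

/-- Let `H` be bipartite with sides `¬ s` and `s`, where a vertex `v` on the side `¬ s` already has
`e v` labels `2`, and a vertex on the side `s` already has `e v` labels `3`. Then labels `2` and
`3` can be put on some edges of `H` such that the resulting pairs of numbers of labels `2` and `3`
tell adjacent vertices apart, up to a matching of vertices without such labels. -/
theorem exists_bipartite_labelling {V : Type*} [Fintype V] (H : SimpleGraph V) (s : V → Prop)
    [DecidablePred s] (hs : ∀ u v, H.Adj u v → (s u ↔ ¬ s v)) (e : V → ℕ) :
    ∃ (H₂ H₃ : SimpleGraph V) (a b : V → ℕ), H₂ ≤ H ∧ H₃ ≤ H ∧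
      (∀ u v, H₂.Adj u v → ¬ H₃.Adj u v) ∧
      (∀ v, a v = (H₂.neighborSet v).ncard + if s v then 0 else e v) ∧
      (∀ v, b v = (H₃.neighborSet v).ncard + if s v then e v else 0) ∧
      (∀ v, a v = 0 ∨ b v = 0 ∨ (a v = 1 ∧ b v = 2)) ∧
      (∀ u v, H.Adj u v → a u = a v → b u = b v → a u = 0 ∧ b u = 0) ∧
      (∀ v u w, H.Adj v u → H.Adj v w → a v = 0 → b v = 0 → a u = 0 → b u = 0 →
        a w = 0 → b w = 0 → u = w) := by
  -- Vertices of `s` already holding 3s are dropped: without further labels their pair is `(0, e)`,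
  -- apart from neighbours with `b = 0` and `a` positive.
  let Γ : SimpleGraph V :=
    { Adj := fun u v => H.Adj u v ∧ ¬ (s u ∧ 0 < e u) ∧ ¬ (s v ∧ 0 < e v)
      symm := ⟨fun u v h => ⟨h.1.symm, h.2.2, h.2.1⟩⟩
      loopless := ⟨fun u h => h.1.ne rfl⟩ }
  obtain ⟨J, X, hJ, hX⟩ := exists_isParitySubgraph Γ s (fun u v h => hs u v h.1) e
  have hJ0 : ∀ v, (J.neighborSet v).ncard = 0 ↔ ∀ u, ¬ J.Adj v u := by
    intro v
    rw [Set.ncard_eq_zero, Set.eq_empty_iff_forall_notMem]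
    rfl
  -- `Z x` holds the neighbours that would share the pair `(0, 0)` with a defect `x`. One such
  -- neighbour is allowed; `Y` collects the defects with more, which need repair.
  set Z : V → Set V := fun x => {y | H.Adj x y ∧ e y = 0 ∧ (J.neighborSet y).ncard = 0} with hZ
  set Y : Set V := {x | x ∈ X ∧ 2 ≤ (Z x).ncard} with hY
  -- Repair by a 2 on an `M`-edge gives `x` the pair `(1, 0)` and `w` the pair `(1, 2)`. An
  -- unmatched `x` instead puts 3s on two edges to `Z x` and gets `(0, 2)`; by maximality none of
  -- its neighbours keeps `(0, 2)`.
  obtain ⟨M, hM, hM1, hM2, hMmax⟩ := exists_maximal_pairing H Y (fun w => e w = 2)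
  have hT : ∀ x, ∃ T ⊆ Z x, x ∈ Y → T.ncard = 2 := by
    intro x
    by_cases hx : x ∈ Y
    · obtain ⟨T, h1, h2⟩ := Set.exists_subset_card_eq hx.2
      exact ⟨T, h1, fun _ => h2⟩
    · exact ⟨∅, by simp, fun h => absurd h hx⟩
  choose T hTZ hT2 using hT
  set S : V → V → Prop := fun x y => x ∈ Y ∧ (∀ w, ¬ M x w) ∧ y ∈ T x with hS
  have hXs : ∀ x ∈ X, ¬ s x := fun x hx => (hJ.defect x hx).1
  have hMs : ∀ x w, M x w → x ∈ X ∧ s w := by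
    intro x w h
    have h1 := hM x w h
    exact ⟨h1.1.1, by have := hs _ _ h1.2.1; have := hXs x h1.1.1; tauto⟩
  have hSs : ∀ x y, S x y → x ∈ X ∧ s y ∧ H.Adj x y ∧ e y = 0 ∧ ∀ u, ¬ J.Adj y u := by
    intro x y h
    have h1 := hTZ x h.2.2
    exact ⟨h.1.1, by have := hs _ _ h1.1; have := hXs x h.1.1; tauto, h1.1, h1.2.1,
      (hJ0 y).1 h1.2.2⟩
  have hJB : ∀ v, s v → 0 < e v → ∀ u, ¬ J.Adj v u := fun v h1 h2 u h => (hJ.le h).2.1 ⟨h1, h2⟩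
  have hJX : ∀ x ∈ X, ∀ u, ¬ J.Adj x u := fun x hx => (hJ0 x).1 (hJ.defect x hx).2.2
  let H₂ : SimpleGraph V :=
    { Adj := fun u v => J.Adj u v ∨ M u v ∨ M v u
      symm := ⟨fun u v h => by
        rcases h with h | h | h
        exacts [Or.inl h.symm, Or.inr (Or.inr h), Or.inr (Or.inl h)]⟩
      loopless := ⟨fun u h => by
        rcases h with h | h | h
        exacts [h.ne rfl, (hM _ _ h).2.1.ne rfl, (hM _ _ h).2.1.ne rfl]⟩ }
  let H₃ : SimpleGraph V :=
    { Adj := fun u v => S u v ∨ S v u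
      symm := ⟨fun u v h => h.symm⟩
      loopless := ⟨fun u h => by
        rcases h with h | h
        exacts [(hSs _ _ h).2.2.1.ne rfl, (hSs _ _ h).2.2.1.ne rfl]⟩ }
  have hdisj : ∀ u v, S u v → ¬ H₂.Adj u v := by
    rintro u v h (h' | h' | h')
    · exact (hSs _ _ h).2.2.2.2 u h'.symm
    · exact h.2.1 v h'
    · exact hXs _ (hSs _ _ h).1 (hMs _ _ h').2
  set a : V → ℕ := fun v => (H₂.neighborSet v).ncard + if s v then 0 else e v with ha
  set b : V → ℕ := fun v => (H₃.neighborSet v).ncard + if s v then e v else 0 with hb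
  have hcongr : ∀ (K : SimpleGraph V) (v : V) (W : Set V), (∀ u, K.Adj v u ↔ u ∈ W) →
      (K.neighborSet v).ncard = W.ncard := fun K v W h => congrArg Set.ncard (Set.ext h)
  have hA : ∀ u, ¬ s u →
      (b u = 0 ∧ (Odd (a u) ∨
        (0 < e u ∧ a u = e u ∧ ∀ y, Γ.Adj u y → (J.neighborSet y).ncard = 0))) ∨
      (u ∈ X ∧ a u = 0 ∧ b u = 0 ∧ (Z u).ncard ≤ 1) ∨
      (a u = 1 ∧ b u = 0) ∨
      (a u = 0 ∧ b u = 2 ∧ ∀ w, H.Adj u w → e w = 2 → ∃ x, M x w) := by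
    intro u hu
    have hnM : ∀ x, ¬ M x u := fun x h => hu (hMs _ _ h).2
    have hnS : ∀ x, ¬ S x u := fun x h => hu (hSs _ _ h).2.1
    by_cases huX : u ∈ X
    · right
      have he := (hJ.defect u huX).2.1
      by_cases hm : ∃ w, M u w
      · obtain ⟨w, hw⟩ := hm
        have h2 := hcongr H₂ u {w} (fun v => by
          simp only [H₂, hJX u huX v, hnM, Set.mem_singleton_iff, false_or, or_false]
          exact ⟨fun h => hM1 _ _ _ h hw, fun h => h ▸ hw⟩)
        have h3 := hcongr H₃ u ∅ (fun v => by
          simp only [H₃, hnS, Set.mem_empty_iff_false, or_false, iff_false]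
          exact fun h => h.2.1 w hw)
        right; left
        simp [ha, hb, h2, h3, hu, he]
      · push Not at hm
        have h2 := hcongr H₂ u ∅ (fun v => by simp [H₂, hJX u huX v, hnM, hm])
        by_cases huY : u ∈ Y
        · have h3 := hcongr H₃ u (T u) (fun v => by
            simp only [H₃, hnS, or_false]
            exact ⟨fun h => h.2.2, fun h => ⟨huY, hm, h⟩⟩)
          right; right
          refine ⟨by simp [ha, h2, hu, he], by simp [hb, h3, hu, hT2 u huY], ?_⟩
          exact fun w h1 h2 => hMmax u huY w h1 h2 hm
        · have h3 := hcongr H₃ u ∅ (fun v => by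
            simp only [H₃, hnS, Set.mem_empty_iff_false, or_false, iff_false]
            exact fun h => huY h.1)
          left
          refine ⟨huX, by simp [ha, h2, hu, he], by simp [hb, h3, hu], ?_⟩
          by_contra h
          exact huY ⟨huX, by omega⟩
    · left
      have h2 := hcongr H₂ u (J.neighborSet u) (fun v => by
        simp only [H₂, hnM, mem_neighborSet, or_false, or_iff_left_iff_imp]
        exact fun h => absurd (hMs _ _ h).1 huX)
      have h3 := hcongr H₃ u ∅ (fun v => by
        simp only [H₃, hnS, Set.mem_empty_iff_false, or_false, iff_false]
        exact fun h => huX (hSs _ _ h).1)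
      refine ⟨by simp [hb, h3, hu], ?_⟩
      simp only [ha, h2, hu, if_false]
      rcases hJ.odd u trivial hu huX with h | ⟨h4, h5, h6⟩
      · left
        rwa [add_comm]
      · right
        exact ⟨h4, by omega, h6⟩
  have hB : ∀ y, s y →
      (e y = 0 ∧ ((a y = (J.neighborSet y).ncard ∧ Even (a y) ∧ b y = 0) ∨
        (a y = 0 ∧ b y = 1))) ∨
      (0 < e y ∧ ((a y = 0 ∧ b y = e y ∧ ∀ x, ¬ M x y) ∨ (a y = 1 ∧ b y = 2))) := by
    intro y hy
    have hnM : ∀ x, ¬ M y x := fun x h => hXs _ (hMs _ _ h).1 hy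
    have hnS : ∀ x, ¬ S y x := fun x h => hXs _ (hSs _ _ h).1 hy
    by_cases he : e y = 0
    · left
      refine ⟨he, ?_⟩
      have h2 := hcongr H₂ y (J.neighborSet y) (fun v => by
        simp only [H₂, hnM, mem_neighborSet, false_or, or_iff_left_iff_imp]
        intro h
        have := (hM _ _ h).2.2
        omega)
      by_cases hS' : ∃ x, S x y
      · right
        obtain ⟨x, hx⟩ := hS'
        have h3 := hcongr H₃ y {x} (fun v => by
          simp only [H₃, hnS, false_or, Set.mem_singleton_iff]
          refine ⟨fun h => ?_, fun h => h ▸ hx⟩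
          -- As `e y = 0`, the vertex `y` lies in `Γ`, and two defects adjacent to it would share a
          -- component. So `y` gets only one 3.
          have hadj : ∀ z, S z y → Γ.Adj z y := fun z hz =>
            ⟨(hSs _ _ hz).2.2.1, fun hh => hXs _ (hSs _ _ hz).1 hh.1, fun hh => by omega⟩
          exact hX _ (hSs _ _ h).1 _ (hSs _ _ hx).1
            ((hadj v h).reachable.trans (hadj x hx).symm.reachable))
        have h4 := (hJ0 y).2 (hSs _ _ hx).2.2.2.2
        simp [ha, hb, h2, h3, h4, hy, he]
      · left
        push Not at hS'
        have h3 := hcongr H₃ y ∅ (fun v => by simp [H₃, hnS, hS'])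
        have := hJ.even y trivial hy
        simp [ha, hb, h2, h3, hy, he, this]
    · right
      refine ⟨Nat.pos_of_ne_zero he, ?_⟩
      have h3 := hcongr H₃ y ∅ (fun v => by
        simp only [H₃, hnS, false_or, Set.mem_empty_iff_false, iff_false]
        exact fun h => he (hSs _ _ h).2.2.2.1)
      have hj := hJB y hy (Nat.pos_of_ne_zero he)
      by_cases hm : ∃ x, M x y
      · obtain ⟨x, hx⟩ := hm
        have h2 := hcongr H₂ y {x} (fun v => by
          simp only [H₂, hj, hnM, Set.mem_singleton_iff, false_or]
          exact ⟨fun h => hM2 _ _ _ h hx, fun h => h ▸ hx⟩)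
        right
        simp [ha, hb, h2, h3, hy, (hM _ _ hx).2.2]
      · push Not at hm
        have h2 := hcongr H₂ y ∅ (fun v => by simp [H₂, hj, hnM, hm])
        left
        refine ⟨by simp [ha, h2, hy], by simp [hb, h3, hy], hm⟩
  have hne : ∀ u v, H.Adj u v → ¬ s u → s v → a u = a v → b u = b v → a u = 0 ∧ b u = 0 := by
    intro u v huv hu hv h1 h2
    have hΓ : e v = 0 → Γ.Adj u v := fun h => ⟨huv, fun hh => hu hh.1, fun hh => by omega⟩
    rcases hB v hv with ⟨hev, ⟨h3, h4, h5⟩ | ⟨h3, h4⟩⟩ | ⟨hev, ⟨h3, h4, h5⟩ | ⟨h3, h4⟩⟩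
    · rcases hA u hu with ⟨k1, k2 | ⟨k2, k3, k4⟩⟩ | ⟨_, k2, k3, -⟩ | ⟨k1, k2⟩ | ⟨k1, k2, -⟩
      · rw [h1] at k2
        exact absurd h4 (Nat.not_even_iff_odd.2 k2)
      · have := k4 v (hΓ hev)
        omega
      · exact ⟨k2, k3⟩
      · rw [← h1, k1] at h4
        exact absurd h4 (by decide)
      · omega
    · rcases hA u hu with ⟨k1, -⟩ | ⟨_, k2, k3, -⟩ | ⟨k1, k2⟩ | ⟨k1, k2, -⟩ <;> omega
    · rcases hA u hu with ⟨k1, -⟩ | ⟨_, k2, k3, -⟩ | ⟨k1, k2⟩ | ⟨k1, k2, k3⟩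
      · omega
      · omega
      · omega
      · obtain ⟨x, hx⟩ := k3 v huv (by omega)
        exact absurd hx (h5 x)
    · rcases hA u hu with ⟨k1, -⟩ | ⟨_, k2, k3, -⟩ | ⟨k1, k2⟩ | ⟨k1, k2, -⟩ <;> omega
  have hA0 : ∀ u, ¬ s u → a u = 0 → b u = 0 → u ∈ X ∧ (Z u).ncard ≤ 1 := by
    intro u hu h1 h2
    rcases hA u hu with ⟨k1, k2 | ⟨k2, k3, k4⟩⟩ | ⟨k1, k2, k3, k4⟩ | ⟨k1, k2⟩ | ⟨k1, k2, -⟩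
    · rw [h1] at k2
      exact absurd k2 (by decide)
    · omega
    · exact ⟨k1, k4⟩
    · omega
    · omega
  have hB0 : ∀ y, s y → a y = 0 → b y = 0 → e y = 0 ∧ (J.neighborSet y).ncard = 0 := by
    intro v hv h1 h2
    rcases hB v hv with ⟨hev, ⟨h3, h4, h5⟩ | ⟨h3, h4⟩⟩ | ⟨hev, ⟨h3, h4, h5⟩ | ⟨h3, h4⟩⟩ <;> omega
  refine ⟨H₂, H₃, a, b, ?_, ?_, ?_, fun v => rfl, fun v => rfl, ?_, ?_, ?_⟩
  · rintro u v (h | h | h)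
    exacts [(hJ.le h).1, (hM _ _ h).2.1, (hM _ _ h).2.1.symm]
  · rintro u v (h | h)
    exacts [(hSs _ _ h).2.2.1, (hSs _ _ h).2.2.1.symm]
  · rintro u v h (h' | h')
    exacts [hdisj _ _ h' h, hdisj _ _ h' h.symm]
  · intro v
    by_cases hv : s v
    · rcases hB v hv with ⟨-, ⟨-, -, h⟩ | ⟨h, -⟩⟩ | ⟨-, ⟨h, -⟩ | h⟩ <;> tauto
    · rcases hA v hv with ⟨h, -⟩ | ⟨-, h, -⟩ | ⟨-, h⟩ | ⟨h, -⟩ <;> tauto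
  · intro u v huv h1 h2
    have := hs u v huv
    by_cases hu : s u
    · have := hne v u huv.symm (by tauto) hu h1.symm h2.symm
      omega
    · exact hne u v huv hu (by tauto) h1 h2
  · intro v u w hvu hvw av bv au bu aw bw
    have s1 := hs v u hvu
    have s2 := hs v w hvw
    by_cases hv : s v
    -- Neighbours of `v` with pair `(0, 0)` are defects in one component of `Γ`, hence equal.
    · have hadj : ∀ z, ¬ s z → H.Adj v z → Γ.Adj z v := fun z hz hvz =>
        ⟨hvz.symm, fun hh => hz hh.1, fun hh => by have := hB0 v hv av bv; omega⟩
      exact hX _ (hA0 u (by tauto) au bu).1 _ (hA0 w (by tauto) aw bw).1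
        ((hadj u (by tauto) hvu).reachable.trans (hadj w (by tauto) hvw).symm.reachable)
    · exact (Set.ncard_le_one).1 (hA0 v hv av bv).2 u ⟨hvu, hB0 u (by tauto) au bu⟩ w
        ⟨hvw, hB0 w (by tauto) aw bw⟩

end SimpleGraph

/-! ### Labelling the edges below the higher levels -/

namespace SimpleGraph

open Finset

/-- A vertex that sees all smaller levels has sets of such neighbours with any given numbers of
even and odd levels, within the obvious bounds. -/
theorem exists_lower_neighbors {V : Type*} [DecidableEq V] (G : SimpleGraph V) (lev : V → ℕ) (v : V)
    (hv : ∀ j < lev v, ∃ u, G.Adj v u ∧ lev u = j) (p q : ℕ) (hp : 2 * p ≤ lev v + 1)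
    (hq : 2 * q ≤ lev v) :
    ∃ C : Finset V, (∀ u ∈ C, G.Adj v u ∧ lev u < lev v) ∧
      #{u ∈ C | Even (lev u)} = p ∧ #{u ∈ C | ¬ Even (lev u)} = q := by
  have hv' : ∀ j, ∃ u, j < lev v → G.Adj v u ∧ lev u = j := fun j => by
    by_cases h : j < lev v
    · obtain ⟨u, hu⟩ := hv j h
      exact ⟨u, fun _ => hu⟩
    · exact ⟨v, fun h' => absurd h' h⟩
  choose U hU using hv'
  have hE : ∀ j ∈ range p, lev (U (2 * j)) = 2 * j := fun j hj =>
    (hU _ (by have := mem_range.1 hj; omega)).2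
  have hO : ∀ j ∈ range q, lev (U (2 * j + 1)) = 2 * j + 1 := fun j hj =>
    (hU _ (by have := mem_range.1 hj; omega)).2
  have hEp : ∀ u ∈ (range p).image (fun j => U (2 * j)), Even (lev u) := by
    intro u hu
    obtain ⟨j, hj, rfl⟩ := mem_image.1 hu
    rw [hE j hj]
    exact even_two_mul j
  have hOp : ∀ u ∈ (range q).image (fun j => U (2 * j + 1)), ¬ Even (lev u) := by
    intro u hu
    obtain ⟨j, hj, rfl⟩ := mem_image.1 hu
    rw [hO j hj, Nat.not_even_iff_odd]
    exact odd_two_mul_add_one j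
  refine ⟨(range p).image (fun j => U (2 * j)) ∪ (range q).image (fun j => U (2 * j + 1)),
    ?_, ?_, ?_⟩
  · intro u hu
    rcases mem_union.1 hu with hu | hu
    · obtain ⟨j, hj, rfl⟩ := mem_image.1 hu
      have hlt : 2 * j < lev v := by have := mem_range.1 hj; omega
      exact ⟨(hU _ hlt).1, by rw [hE j hj]; exact hlt⟩
    · obtain ⟨j, hj, rfl⟩ := mem_image.1 hu
      have hlt : 2 * j + 1 < lev v := by have := mem_range.1 hj; omega
      exact ⟨(hU _ hlt).1, by rw [hO j hj]; exact hlt⟩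
  · rw [filter_union, filter_true_of_mem hEp, filter_false_of_mem hOp, union_empty,
      card_image_of_injOn, card_range]
    intro i hi j hj h
    have h1 := hE i hi
    have h2 := hE j hj
    dsimp only at h
    rw [h] at h1
    omega
  · rw [filter_union, filter_true_of_mem hOp, filter_false_of_mem (by simpa using hEp),
      empty_union, card_image_of_injOn, card_range]
    intro i hi j hj h
    have h1 := hO i hi
    have h2 := hO j hj
    dsimp only at h
    rw [h] at h1
    omega

/-- Choice of the edges labelled `2` or `3` that leave a vertex of level at least `2` towards lower
levels, the label being `2` exactly if the lower end has even level. -/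
theorem exists_lower_choice {V : Type*} [Fintype V] (G : SimpleGraph V) (lev : V → ℕ)
    (hlev : ∀ v, ∀ j < lev v, ∃ u, G.Adj v u ∧ lev u = j) :
    ∃ C : V → Finset V, (∀ v, ∀ u ∈ C v, lev u < lev v) ∧ ∀ v,
      (∀ u ∈ C v, G.Adj v u) ∧ (lev v ≤ 1 → C v = ∅) ∧
      (∀ k, 1 ≤ k → lev v = 2 * k → #{u ∈ C v | ¬ Even (lev u)} = k ∧
        1 ≤ #{u ∈ C v | Even (lev u)} + {w | v ∈ C w}.ncard ∧
        (#{u ∈ C v | Even (lev u)} + {w | v ∈ C w}.ncard) % 2 = k % 2) ∧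
      (∀ m, 1 ≤ m → lev v = 2 * m + 1 → #{u ∈ C v | Even (lev u)} = m + 1 ∧
        1 ≤ #{u ∈ C v | ¬ Even (lev u)} + {w | v ∈ C w}.ncard ∧
        (#{u ∈ C v | ¬ Even (lev u)} + {w | v ∈ C w}.ncard) % 2 = m % 2) := by
  classical
  refine exists_descending_choice lev (fun v C n =>
      (∀ u ∈ C, G.Adj v u) ∧ (lev v ≤ 1 → C = ∅) ∧
      (∀ k, 1 ≤ k → lev v = 2 * k → #{u ∈ C | ¬ Even (lev u)} = k ∧
        1 ≤ #{u ∈ C | Even (lev u)} + n ∧ (#{u ∈ C | Even (lev u)} + n) % 2 = k % 2) ∧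
      (∀ m, 1 ≤ m → lev v = 2 * m + 1 → #{u ∈ C | Even (lev u)} = m + 1 ∧
        1 ≤ #{u ∈ C | ¬ Even (lev u)} + n ∧
        (#{u ∈ C | ¬ Even (lev u)} + n) % 2 = m % 2)) fun v n => ?_
  -- One extra edge corrects the parity, and zero or two keep it; two are needed only if `n = 0`,
  -- and then `k` is even, so `2 ≤ k`.
  have hcorr : ∀ k, 1 ≤ k → ∃ j ≤ k, 1 ≤ j + n ∧ (j + n) % 2 = k % 2 := by
    intro k hk
    by_cases h : (1 + n) % 2 = k % 2
    · exact ⟨1, hk, by omega, h⟩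
    · by_cases hn : n = 0
      · exact ⟨2, by omega, by omega, by omega⟩
      · exact ⟨0, by omega, by omega, by omega⟩
  by_cases hl : lev v ≤ 1
  · exact ⟨∅, by simp, by simp, by simp, fun k _ _ => by omega, fun m _ _ => by omega⟩
  rcases Nat.even_or_odd' (lev v) with ⟨k, hk | hk⟩
  · obtain ⟨j, hj, h1, h2⟩ := hcorr k (by omega)
    obtain ⟨C, hC, hp, hq⟩ :=
      exists_lower_neighbors G lev v (hlev v) j k (by omega) (by omega)
    refine ⟨C, fun u hu => (hC u hu).2, fun u hu => (hC u hu).1, fun h => absurd h hl, ?_, ?_⟩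
    · intro k' _ hk'
      obtain rfl : k = k' := by omega
      rw [hp, hq]
      exact ⟨rfl, h1, h2⟩
    · intro m _ hm
      omega
  · obtain ⟨j, hj, h1, h2⟩ := hcorr k (by omega)
    obtain ⟨C, hC, hp, hq⟩ :=
      exists_lower_neighbors G lev v (hlev v) (k + 1) j (by omega) (by omega)
    refine ⟨C, fun u hu => (hC u hu).2, fun u hu => (hC u hu).1, fun h => absurd h hl, ?_, ?_⟩
    · intro k' _ hk'
      omega
    · intro m _ hm
      obtain rfl : k = m := by omega
      rw [hp, hq]
      exact ⟨rfl, h1, h2⟩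

/-- The subgraph formed by a graph `K` on the levels `0` and `1` and by the chosen edges whose
lower end satisfies `q`. -/
def addChosen {V : Type*} (K : SimpleGraph V) (lev : V → ℕ) (C : V → Finset V)
    (hC : ∀ v, ∀ u ∈ C v, lev u < lev v) (q : V → Prop) : SimpleGraph V where
  Adj u v := K.Adj u v ∨ (v ∈ C u ∧ q v) ∨ (u ∈ C v ∧ q u)
  symm := ⟨fun _ _ h => by
    rcases h with h | h | h
    exacts [Or.inl h.symm, Or.inr (Or.inr h), Or.inr (Or.inl h)]⟩
  loopless := ⟨fun u h => by
    rcases h with h | h | h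
    exacts [h.ne rfl, (hC _ _ h.1).ne rfl, (hC _ _ h.1).ne rfl]⟩

/-- The three kinds of neighbours are disjoint: `K` lives on levels that choose nothing, and choices
strictly descend. -/
theorem ncard_neighborSet_addChosen {V : Type*} [Finite V] (K : SimpleGraph V) (lev : V → ℕ)
    (C : V → Finset V) (hC : ∀ v, ∀ u ∈ C v, lev u < lev v) (q : V → Prop) [DecidablePred q]
    (hK : ∀ u v, K.Adj u v → lev u ≤ 1) (hC1 : ∀ v, lev v ≤ 1 → C v = ∅) (v : V) :
    ((K.addChosen lev C hC q).neighborSet v).ncard =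
      (K.neighborSet v).ncard + (#{u ∈ C v | q u} + if q v then {w | v ∈ C w}.ncard else 0) := by
  have hset : (K.addChosen lev C hC q).neighborSet v =
      K.neighborSet v ∪ (({u ∈ C v | q u} : Finset V) ∪ {w | v ∈ C w ∧ q v}) := by
    ext u
    simp [addChosen]
  have hlast : {w | v ∈ C w ∧ q v}.ncard = if q v then {w | v ∈ C w}.ncard else 0 := by
    split_ifs with h <;> simp [h]
  rw [hset, Set.ncard_union_eq, Set.ncard_union_eq, Set.ncard_coe_finset, hlast]
  · rw [Set.disjoint_left]
    intro u hu hu'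
    have h1 := hC v u (mem_filter.1 (mem_coe.1 hu)).1
    have h2 := hC u v hu'.1
    omega
  · rw [Set.disjoint_left]
    rintro u hu (hu' | hu')
    · have h1 := (mem_filter.1 (mem_coe.1 hu')).1
      rw [hC1 v (hK v u hu)] at h1
      simp at h1
    · have h1 := hu'.1
      rw [hC1 u (hK u v hu.symm)] at h1
      simp at h1

end SimpleGraph

/-! ### Combining low and high levels -/

open SimpleGraph Finset in
theorem theorem3p1 {V : Type*} [Fintype V] [DecidableEq V] (G : SimpleGraph V)
    [DecidableRel G.Adj] :
    ∃ ℓ : G.Labelling 3,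
      G.InducesMatchingAndIsolated (ℓ.prodClass 1) ∧
        ∀ x : ℕ, x ≠ 1 → G.IsIndepSet (ℓ.prodClass x) := by
  obtain ⟨lev, hne, hgreedy⟩ := exists_greedy_level G
  obtain ⟨C, hC, hC'⟩ := exists_lower_choice G lev hgreedy
  set e : V → ℕ := fun v => {w | v ∈ C w}.ncard with he
  let H : SimpleGraph V := G.within {v | lev v ≤ 1}
  obtain ⟨H₂, H₃, a, b, hH₂, hH₃, hdisj, ha, hb, htype, hH, huniq⟩ :=
    exists_bipartite_labelling H (fun v => ¬ Even (lev v)) (by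
      rintro u v ⟨h1, h2, h3⟩
      have h2 : lev u ≤ 1 := h2
      have h3 : lev v ≤ 1 := h3
      have := hne u v h1
      rw [Nat.even_iff, Nat.even_iff]
      omega) e
  have hC1 : ∀ v, lev v ≤ 1 → C v = ∅ := fun v => (hC' v).2.1
  have hdeg₂ := ncard_neighborSet_addChosen H₂ lev C hC (fun v => Even (lev v))
    (fun u v h => (hH₂ h).2.1) hC1
  have hdeg₃ := ncard_neighborSet_addChosen H₃ lev C hC (fun v => ¬ Even (lev v))
    (fun u v h => (hH₃ h).2.1) hC1
  set A : V → ℕ := fun v => a v + #{u ∈ C v | Even (lev u)} with hA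
  set B : V → ℕ := fun v => b v + #{u ∈ C v | ¬ Even (lev u)} with hB
  have hlow : ∀ v, lev v ≤ 1 → A v = a v ∧ B v = b v := by
    intro v hv
    simp [hA, hB, hC1 v hv]
  have hiso : ∀ (K : SimpleGraph V), K ≤ H → ∀ v, 2 ≤ lev v → (K.neighborSet v).ncard = 0 := by
    intro K hK v hv
    rw [Set.ncard_eq_zero, Set.eq_empty_iff_forall_notMem]
    intro u hu
    have h1 : lev v ≤ 1 := (hK hu).2.1
    omega
  have hhigh : ∀ v, 2 ≤ lev v →
      (∃ k, 1 ≤ k ∧ lev v = 2 * k ∧ B v = k ∧ 1 ≤ A v ∧ A v % 2 = k % 2) ∨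
      (∃ m, 1 ≤ m ∧ lev v = 2 * m + 1 ∧ A v = m + 1 ∧ 1 ≤ B v ∧ B v % 2 = m % 2) := by
    intro v hv
    obtain ⟨-, -, h1, h2⟩ := hC' v
    have h3 := ha v
    have h4 := hb v
    rw [hiso H₂ hH₂ v hv] at h3
    rw [hiso H₃ hH₃ v hv] at h4
    rcases Nat.even_or_odd' (lev v) with ⟨k, hk | hk⟩
    · left
      have hev : Even (lev v) := by rw [hk]; exact even_two_mul k
      simp only [hev, not_true_eq_false, if_false] at h3 h4
      obtain ⟨h5, h6, h7⟩ := h1 k (by omega) hk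
      refine ⟨k, by omega, hk, ?_, ?_, ?_⟩ <;> simp only [hA, hB, h3, h4, he] <;> omega
    · right
      have hev : ¬ Even (lev v) := by
        rw [hk, Nat.not_even_iff_odd]; exact odd_two_mul_add_one k
      simp only [hev, not_false_eq_true, if_true] at h3 h4
      obtain ⟨h5, h6, h7⟩ := h2 k (by omega) hk
      refine ⟨k, by omega, hk, ?_, ?_, ?_⟩ <;> simp only [hA, hB, h3, h4, he] <;> omega
  have hhigh0 : ∀ v, A v = 0 → lev v ≤ 1 := by
    intro v hv
    by_contra h
    rcases hhigh v (by omega) with ⟨k, _, _, _, _, _⟩ | ⟨m, _, _, _, _, _⟩ <;> omega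
  -- Both coordinates at `v` are positive, and `(1, 2)` is excluded: `B = k = 2` would make `A`
  -- even, and `A = m + 1 = 1` would give `m = 0`.
  have hmixed : ∀ u v, lev u ≤ 1 → 2 ≤ lev v → A u = A v → B u ≠ B v := by
    intro u v hu hv h1 h2
    have h3 := hlow u hu
    have h4 := htype u
    rcases hhigh v hv with ⟨k, _, _, _, _, _⟩ | ⟨m, _, _, _, _, _⟩ <;> omega
  have hGne : ∀ u v, G.Adj u v → A u = A v → B u = B v → A u = 0 ∧ B u = 0 := by
    intro u v huv h1 h2
    rcases Nat.lt_or_ge (lev u) 2 with hu | hu <;> rcases Nat.lt_or_ge (lev v) 2 with hv | hv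
    · have hu' := hlow u (by omega)
      have hv' := hlow v (by omega)
      have := hH u v ⟨huv, Nat.le_of_lt_succ hu, Nat.le_of_lt_succ hv⟩ (by omega) (by omega)
      omega
    · exact absurd h2 (hmixed u v (by omega) hv h1)
    · exact absurd h2.symm (hmixed v u (by omega) hu h1.symm)
    · have := hne u v huv
      rcases hhigh u hu with ⟨k, _, _, _, _, _⟩ | ⟨m, _, _, _, _, _⟩ <;>
        rcases hhigh v hv with ⟨k', _, _, _, _, _⟩ | ⟨m', _, _, _, _, _⟩ <;> omega
  refine exists_labelling_of_degree_pairs G (H₂.addChosen lev C hC (fun v => Even (lev v)))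
    (H₃.addChosen lev C hC (fun v => ¬ Even (lev v))) ?_ ?_ ?_ A B ?_ ?_ hGne ?_
  · rintro u v (h | h | h)
    exacts [(hH₂ h).1, (hC' _).1 _ h.1, ((hC' _).1 _ h.1).symm]
  · rintro u v (h | h | h)
    exacts [(hH₃ h).1, (hC' _).1 _ h.1, ((hC' _).1 _ h.1).symm]
  · have hmem : ∀ u v, u ∈ C v → ¬ H.Adj v u := fun u v h h' => by
      rw [hC1 v h'.2.1] at h
      simp at h
    rintro u v (h | h | h) (h' | h' | h')
    · exact hdisj u v h h'
    · exact hmem _ _ h'.1 (hH₂ h)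
    · exact hmem _ _ h'.1 (hH₂ h).symm
    · exact hmem _ _ h.1 (hH₃ h')
    · exact h'.2 h.2
    · exact (hC _ _ h.1).asymm (hC _ _ h'.1)
    · exact hmem _ _ h.1 (hH₃ h').symm
    · exact (hC _ _ h.1).asymm (hC _ _ h'.1)
    · exact h'.2 h.2
  · intro v
    rw [hdeg₂ v]
    simp only [hA, ha v, ite_not, he]
    omega
  · intro v
    rw [hdeg₃ v]
    simp only [hB, hb v, he]
    omega
  · intro v u w hvu hvw av bv au bu aw bw
    have lv := hhigh0 v av
    have lu := hhigh0 u au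
    have lw := hhigh0 w aw
    have h1 := hlow v lv
    have h2 := hlow u lu
    have h3 := hlow w lw
    exact huniq v u w ⟨hvu, lv, lu⟩ ⟨hvw, lv, lw⟩ (by omega) (by omega) (by omega) (by omega)
      (by omega) (by omega)
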